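/- Let $G$ be a cograph on $n$ vertices, that is, a finite graph that can be obtained from single-vertex graphs by repeatedly taking the disjoint union of two graphs or the complete join of two graphs (the disjoint union together with all edges between the two vertex sets). Let $k$ be an integer. For independent sets $I,J$ of $G$, say that $J$ is obtained from $I$ by one TAR-step if $J\neq I$ and there is a vertex $v$ with $I\cup\{v\}=J$ or $I=J\cup\{v\}$. Let $\mathrm{TAR}_k(G)$ be the graph whose vertices are the independent sets of $G$ of size at least $k$, two of them being adjacent if one is obtained from the other by one TAR-step. A $k$-TAR-sequence of length $p$ from $A$ to $B$ is a sequence $I_0,\ldots,I_p$ of independent sets of $G$, each of size at least $k$, with $I_0=A$ and $I_p=B$, such that for every $0\le i<p$ either $I_{i+1}=I_i$ or $I_{i+1}$ is obtained from $I_i$ by one TAR-step. Theorem. Let $A$ and $B$ be independent sets of $G$ of size at least $k$ such that $\mathrm{TAR}_k(G)$ contains a path from $A$ to $B$. Then there exists a $k$-TAR-sequence from $A$ to $B$ of length at most $4n-|A|-|B|$. -/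

import Mathlib

/-- Binary trees whose leaves carry a vertex and whose inner nodes are union nodes or join nodes,
with an ordered pair of children (left, right). -/
inductive Cotree (V : Type*) where
  | leaf (v : V) : Cotree V
  | union (l r : Cotree V) : Cotree V
  | join (l r : Cotree V) : Cotree V

namespace Cotree

/-- The vertex set of the graph associated with the root of the tree. -/
def verts {V : Type*} : Cotree V → Set V
  | leaf v => {v}
  | union l r => l.verts ∪ r.verts
  | join l r => l.verts ∪ r.verts

/-- Distinct leaves carry distinct vertices: at every inner node, the graphs of the two children
are vertex disjoint. -/
def WellFormed {V : Type*} : Cotree V → Prop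
  | leaf _ => True
  | union l r => l.WellFormed ∧ r.WellFormed ∧ Disjoint l.verts r.verts
  | join l r => l.WellFormed ∧ r.WellFormed ∧ Disjoint l.verts r.verts

/-- The edges of the graph associated with the root: a leaf gives a single vertex, a union node the
disjoint union of the graphs of its children, and a join node their complete join, which in
addition has all edges between the two vertex sets. (The graph lives on the ambient type `V`; its
vertex set is `verts`, and the vertices outside `verts` are isolated.) -/
def graph {V : Type*} : Cotree V → SimpleGraph V
  | leaf _ => ⊥
  | union l r => l.graph ⊔ r.graph
  | join l r => l.graph ⊔ r.graph ⊔ SimpleGraph.fromRel (fun x y => x ∈ l.verts ∧ y ∈ r.verts)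

/-- `T` is a cotree for `G`: the graph associated with the root of `T` is `G`. -/
def IsCotreeFor {V : Type*} (T : Cotree V) (G : SimpleGraph V) : Prop :=
  T.WellFormed ∧ T.verts = Set.univ ∧ T.graph = G

end Cotree

/-- A cograph is a graph for which there exists a cotree. -/
def IsCograph {V : Type*} (G : SimpleGraph V) : Prop :=
  ∃ T : Cotree V, T.IsCotreeFor G

/-- `J` is obtained from `I` using one TAR-step: adding one token or removing one token. -/
def TARStep {V : Type*} [DecidableEq V] (I J : Finset V) : Prop :=
  I ≠ J ∧ ∃ v : V, I ∪ {v} = J ∨ I = J ∪ {v}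

/-- The graph `TAR_k(G)`: its vertices are the independent sets of `G` of size at least `k`, and
two of them are adjacent if one is obtained from the other using one TAR-step. -/
def TARGraph {V : Type*} [DecidableEq V] (G : SimpleGraph V) (k : ℤ) :
    SimpleGraph {I : Finset V // G.IsIndepSet (I : Set V) ∧ k ≤ (I.card : ℤ)} where
  Adj I J := TARStep I.1 J.1
  symm := ⟨fun _ _ h => ⟨h.1.symm, h.2.imp fun _ hv => hv.symm.imp Eq.symm Eq.symm⟩⟩
  loopless := ⟨fun _ h => h.1 rfl⟩

/-- `A` and `B` are independent sets of size at least `k`, and `TAR_k(G)` contains a path from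
`A` to `B`. -/
def TARReachable {V : Type*} [DecidableEq V] (G : SimpleGraph V) (k : ℤ) (A B : Finset V) : Prop :=
  ∃ (hA : G.IsIndepSet (A : Set V) ∧ k ≤ (A.card : ℤ))
    (hB : G.IsIndepSet (B : Set V) ∧ k ≤ (B.card : ℤ)),
    (TARGraph G k).Reachable ⟨A, hA⟩ ⟨B, hB⟩

/-- `I 0, …, I p` is a `k`-TAR-sequence for `G` from `A` to `B`; its length is `p`.
The values of `I` after index `p` are irrelevant. -/
structure IsTARSequence {V : Type*} [DecidableEq V] (G : SimpleGraph V) (k : ℤ) (A B : Finset V)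
    (p : ℕ) (I : ℕ → Finset V) : Prop where
  start : I 0 = A
  finish : I p = B
  indep : ∀ i ≤ p, G.IsIndepSet (I i : Set V)
  card_ge : ∀ i ≤ p, k ≤ ((I i).card : ℤ)
  step : ∀ i < p, I (i + 1) = I i ∨ TARStep (I i) (I (i + 1))

/-! For an independent set `A` and a threshold `t ≤ |A|`, consider the component of `A` in
`TAR_t(G)`. The claim is that `A` can be transformed, inside its component, into a largest set `C`
of the component that does not depend on the choice of `A`, in such a way that a vertex that loses
its token is dead: it never receives another one. Each move then raises `#tokens + 2 * #dead` by
one; this quantity is `|A|` at first, and at most `2n - |C|` in the end because the vertices in `C`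
are not dead. Going from `A` to `C` and back from `C` to `B` takes at most `4n - |A| - |B| - 2|C|`
moves.

The transformation is built along the cotree. In a disjoint union, the tokens on one part determine
how far the threshold of the other part may be lowered; lowering it and moving on to the next
settled set never loses tokens, so that the two parts can alternate until both thresholds are as low
as possible. In a join, all tokens lie on one part unless there are none, hence the only new event
is that the threshold becomes `0`: then the tokens may leave the part with the smaller independence
number for good, and settle on the other part. -/

namespace TokenReconfiguration

open Finset Relation
open scoped SetFamily

section Complexes

variable {V : Type*} {F F₁ F₂ : Set (Finset V)} {S S₁ S₂ : Set V}

/-- `F` is an abstract simplicial complex with vertices in `S`. Unlike in the usual convention, the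
empty set is a face; not every element of `S` has to be a vertex. -/
structure IsComplexOn (F : Set (Finset V)) (S : Set V) : Prop where
  empty_mem : ∅ ∈ F
  isLowerSet : IsLowerSet F
  subset : ∀ ⦃I⦄, I ∈ F → (I : Set V) ⊆ S

theorem IsComplexOn.disjoint (h₁ : IsComplexOn F₁ S₁) (h₂ : IsComplexOn F₂ S₂)
    (hS : Disjoint S₁ S₂) {I J : Finset V} (hI : I ∈ F₁) (hJ : J ∈ F₂) : Disjoint I J :=
  disjoint_coe.1 (hS.mono (h₁.subset hI) (h₂.subset hJ))

theorem covBy_iff_subset_card {I J : Finset V} : I ⋖ J ↔ I ⊆ J ∧ #J = #I + 1 := by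
  classical
  rw [covBy_iff_card_sdiff_eq_one]
  refine and_congr_right fun h => ?_
  have := card_sdiff_add_card_eq_card h
  omega

/-- The adjacency of `TARGraph`, for a family `F` of finite sets and a threshold `t`. -/
def Adj (F : Set (Finset V)) (t : ℕ) (I J : Finset V) : Prop :=
  (I ∈ F ∧ t ≤ #I) ∧ (J ∈ F ∧ t ≤ #J) ∧ (I ⋖ J ∨ J ⋖ I)

/-- Being in the same connected component for `Adj F t`. -/
def Conn (F : Set (Finset V)) (t : ℕ) : Finset V → Finset V → Prop :=
  ReflTransGen (Adj F t)

theorem Adj.symm {t : ℕ} {I J : Finset V} (h : Adj F t I J) : Adj F t J I :=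
  ⟨h.2.1, h.1, h.2.2.symm⟩

theorem Adj.anti {t t' : ℕ} (ht : t' ≤ t) {I J : Finset V} (h : Adj F t I J) : Adj F t' I J :=
  ⟨⟨h.1.1, ht.trans h.1.2⟩, ⟨h.2.1.1, ht.trans h.2.1.2⟩, h.2.2⟩

theorem Conn.symm {t : ℕ} {I J : Finset V} (h : Conn F t I J) : Conn F t J I := by
  induction h with
  | refl => exact .refl
  | tail _ hadj ih => exact .head hadj.symm ih

theorem Conn.mem {t : ℕ} {I J : Finset V} (h : Conn F t I J) (hI : I ∈ F) : J ∈ F := by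
  cases h with
  | refl => exact hI
  | tail _ hadj => exact hadj.2.1.1

/-- A nonempty set of tokens stays on one side: consecutive sets are comparable, hence they cannot
lie in different complexes with disjoint vertex sets. -/
theorem Conn.of_union_left (h₁ : IsComplexOn F₁ S₁) (h₂ : IsComplexOn F₂ S₂)
    (hS : Disjoint S₁ S₂) {t : ℕ} (ht : 0 < t) {I J : Finset V} (hI : I ∈ F₁)
    (h : Conn (F₁ ∪ F₂) t I J) : Conn F₁ t I J := by
  induction h with
  | refl => exact .refl
  | @tail K L _ hadj ih =>
    have hK : K ∈ F₁ := ih.mem hI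
    obtain ⟨⟨-, htK⟩, ⟨hL, htL⟩, hKL⟩ := hadj
    refine ih.tail ⟨⟨hK, htK⟩, ⟨hL.resolve_right fun hL => ?_, htL⟩, hKL⟩
    have hdisj : Disjoint K L := h₁.disjoint h₂ hS hK hL
    have hK₀ : K ≠ ∅ := card_pos.1 (ht.trans_le htK) |>.ne_empty
    have hL₀ : L ≠ ∅ := card_pos.1 (ht.trans_le htL) |>.ne_empty
    rcases hKL with hKL | hKL
    · exact hK₀ (disjoint_self.1 (hdisj.mono_right hKL.le))
    · exact hL₀ (disjoint_self.1 (hdisj.mono_left hKL.le))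

theorem Conn.of_union_right (h₁ : IsComplexOn F₁ S₁) (h₂ : IsComplexOn F₂ S₂)
    (hS : Disjoint S₁ S₂) {t : ℕ} (ht : 0 < t) {I J : Finset V} (hI : I ∈ F₂)
    (h : Conn (F₁ ∪ F₂) t I J) : Conn F₂ t I J :=
  .of_union_left h₂ h₁ hS.symm ht hI (Set.union_comm F₁ F₂ ▸ h)

theorem not_conn_union (h₁ : IsComplexOn F₁ S₁) (h₂ : IsComplexOn F₂ S₂)
    (hS : Disjoint S₁ S₂) {t : ℕ} (ht : 0 < t) {I J : Finset V} (hI : I ∈ F₁) (hJ : J ∈ F₂)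
    (htJ : t ≤ #J) : ¬Conn (F₁ ∪ F₂) t I J := fun h => by
  have hJ₁ : J ∈ F₁ := (h.of_union_left h₁ h₂ hS ht hI).mem hI
  have hJ₀ : J = ∅ := disjoint_self.1 (h₁.disjoint h₂ hS hJ₁ hJ)
  exact (card_pos.1 (ht.trans_le htJ)).ne_empty hJ₀

end Complexes

section Products

variable {V : Type*} [DecidableEq V] {F₁ F₂ : Set (Finset V)} {S₁ S₂ : Set V}

theorem subset_and_subset_of_union_subset_union (h₁ : IsComplexOn F₁ S₁) (h₂ : IsComplexOn F₂ S₂)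
    (hS : Disjoint S₁ S₂) {I₁ I₂ J₁ J₂ : Finset V} (hI₁ : I₁ ∈ F₁) (hI₂ : I₂ ∈ F₂) (hJ₁ : J₁ ∈ F₁)
    (hJ₂ : J₂ ∈ F₂) (h : I₁ ∪ I₂ ⊆ J₁ ∪ J₂) : I₁ ⊆ J₁ ∧ I₂ ⊆ J₂ :=
  ⟨(h₁.disjoint h₂ hS hI₁ hJ₂).left_le_of_le_sup_right (subset_union_left.trans h),
    (h₁.disjoint h₂ hS hJ₁ hI₂).symm.left_le_of_le_sup_left (subset_union_right.trans h)⟩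

theorem eq_and_eq_of_union_eq_union (h₁ : IsComplexOn F₁ S₁) (h₂ : IsComplexOn F₂ S₂)
    (hS : Disjoint S₁ S₂) {I₁ I₂ J₁ J₂ : Finset V} (hI₁ : I₁ ∈ F₁) (hI₂ : I₂ ∈ F₂) (hJ₁ : J₁ ∈ F₁)
    (hJ₂ : J₂ ∈ F₂) (h : I₁ ∪ I₂ = J₁ ∪ J₂) : I₁ = J₁ ∧ I₂ = J₂ := by
  have hle := subset_and_subset_of_union_subset_union h₁ h₂ hS hI₁ hI₂ hJ₁ hJ₂ h.le
  have hge := subset_and_subset_of_union_subset_union h₁ h₂ hS hJ₁ hJ₂ hI₁ hI₂ h.ge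
  exact ⟨hle.1.antisymm hge.1, hle.2.antisymm hge.2⟩

theorem covBy_or_covBy_of_union_covBy_union (h₁ : IsComplexOn F₁ S₁) (h₂ : IsComplexOn F₂ S₂)
    (hS : Disjoint S₁ S₂) {I₁ I₂ J₁ J₂ : Finset V} (hI₁ : I₁ ∈ F₁) (hI₂ : I₂ ∈ F₂) (hJ₁ : J₁ ∈ F₁)
    (hJ₂ : J₂ ∈ F₂) (h : I₁ ∪ I₂ ⋖ J₁ ∪ J₂) : I₁ ⋖ J₁ ∧ I₂ = J₂ ∨ I₁ = J₁ ∧ I₂ ⋖ J₂ := by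
  obtain ⟨hsub₁, hsub₂⟩ :=
    subset_and_subset_of_union_subset_union h₁ h₂ hS hI₁ hI₂ hJ₁ hJ₂ h.le
  have hcard := (covBy_iff_subset_card.1 h).2
  rw [card_union_of_disjoint (h₁.disjoint h₂ hS hI₁ hI₂),
    card_union_of_disjoint (h₁.disjoint h₂ hS hJ₁ hJ₂)] at hcard
  have hle₁ := card_le_card hsub₁
  have hle₂ := card_le_card hsub₂
  rcases hle₁.eq_or_lt with heq₁ | hlt₁
  · exact .inr ⟨eq_of_subset_of_card_le hsub₁ heq₁.ge,
      covBy_iff_subset_card.2 ⟨hsub₂, by omega⟩⟩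
  · exact .inl ⟨covBy_iff_subset_card.2 ⟨hsub₁, by omega⟩,
      eq_of_subset_of_card_le hsub₂ (by omega)⟩

theorem Adj.of_sups (h₁ : IsComplexOn F₁ S₁) (h₂ : IsComplexOn F₂ S₂) (hS : Disjoint S₁ S₂)
    {k : ℕ} {I₁ I₂ J₁ J₂ : Finset V} (hI₁ : I₁ ∈ F₁) (hI₂ : I₂ ∈ F₂) (hJ₁ : J₁ ∈ F₁)
    (hJ₂ : J₂ ∈ F₂) (h : Adj (F₁ ⊻ F₂) k (I₁ ∪ I₂) (J₁ ∪ J₂)) :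
    Adj F₁ (k - #I₂) I₁ J₁ ∧ I₂ = J₂ ∨ I₁ = J₁ ∧ Adj F₂ (k - #I₁) I₂ J₂ := by
  obtain ⟨⟨-, hkI⟩, ⟨-, hkJ⟩, hIJ⟩ := h
  rw [card_union_of_disjoint (h₁.disjoint h₂ hS hI₁ hI₂)] at hkI
  rw [card_union_of_disjoint (h₁.disjoint h₂ hS hJ₁ hJ₂)] at hkJ
  have hcov : (I₁ ⋖ J₁ ∨ J₁ ⋖ I₁) ∧ I₂ = J₂ ∨ I₁ = J₁ ∧ (I₂ ⋖ J₂ ∨ J₂ ⋖ I₂) := by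
    rcases hIJ with hIJ | hJI
    · exact (covBy_or_covBy_of_union_covBy_union h₁ h₂ hS hI₁ hI₂ hJ₁ hJ₂ hIJ).imp
        (.imp_left .inl) (.imp_right .inl)
    · exact (covBy_or_covBy_of_union_covBy_union h₁ h₂ hS hJ₁ hJ₂ hI₁ hI₂ hJI).imp
        (.imp .inr Eq.symm) (.imp Eq.symm .inr)
  rcases hcov with ⟨hcov₁, rfl⟩ | ⟨rfl, hcov₂⟩
  · exact .inl ⟨⟨⟨hI₁, by omega⟩, ⟨hJ₁, by omega⟩, hcov₁⟩, rfl⟩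
  · exact .inr ⟨rfl, ⟨hI₂, by omega⟩, ⟨hJ₂, by omega⟩, hcov₂⟩

/-- As long as neither part outgrows `C₁` or `C₂`, the threshold `k` for the whole leaves at least
`k - #C₂` tokens to the first part and at least `k - #C₁` to the second, so that the two parts stay
in their components; and there they cannot outgrow `C₁` and `C₂`. -/
theorem Conn.of_sups (h₁ : IsComplexOn F₁ S₁) (h₂ : IsComplexOn F₂ S₂) (hS : Disjoint S₁ S₂)
    {k : ℕ} {C₁ C₂ : Finset V} (hC₁ : C₁ ∈ F₁) (hC₂ : C₂ ∈ F₂)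
    (hmax₁ : ∀ D, Conn F₁ (k - #C₂) C₁ D → #D ≤ #C₁)
    (hmax₂ : ∀ D, Conn F₂ (k - #C₁) C₂ D → #D ≤ #C₂) {D₁ D₂ : Finset V} (hD₁ : D₁ ∈ F₁)
    (hD₂ : D₂ ∈ F₂) (h : Conn (F₁ ⊻ F₂) k (C₁ ∪ C₂) (D₁ ∪ D₂)) :
    Conn F₁ (k - #C₂) C₁ D₁ ∧ Conn F₂ (k - #C₁) C₂ D₂ := by
  generalize hD : D₁ ∪ D₂ = D at h
  induction h generalizing D₁ D₂ with
  | refl =>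
    obtain ⟨rfl, rfl⟩ := eq_and_eq_of_union_eq_union h₁ h₂ hS hD₁ hD₂ hC₁ hC₂ hD
    exact ⟨.refl, .refl⟩
  | tail _ hadj ih =>
    obtain ⟨I₁, hI₁, I₂, hI₂, rfl⟩ := hadj.1.1
    obtain ⟨hconn₁, hconn₂⟩ := ih hI₁ hI₂ rfl
    have hle₁ : #I₁ ≤ #C₁ := hmax₁ I₁ hconn₁
    have hle₂ : #I₂ ≤ #C₂ := hmax₂ I₂ hconn₂
    subst hD
    rcases hadj.of_sups h₁ h₂ hS hI₁ hI₂ hD₁ hD₂ with ⟨hadj₁, rfl⟩ | ⟨rfl, hadj₂⟩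
    · exact ⟨hconn₁.tail (hadj₁.anti (by omega)), hconn₂⟩
    · exact ⟨hconn₁, hconn₂.tail (hadj₂.anti (by omega))⟩

end Products

section Moves

variable {V : Type*} [DecidableEq V] {F F' : Set (Finset V)} {S : Set V} {t t' : ℕ}

/-- A set of tokens together with the set of dead vertices, on which no token may be placed
anymore. -/
@[ext]
structure State (V : Type*) where
  tokens : Finset V
  dead : Finset V

/-- The componentwise union, for states on disjoint parts of a graph. -/
def State.merge (p q : State V) : State V :=
  ⟨p.tokens ∪ q.tokens, p.dead ∪ q.dead⟩

theorem State.merge_comm (p q : State V) : p.merge q = q.merge p :=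
  State.ext (union_comm _ _) (union_comm _ _)

theorem State.merge_empty (p : State V) : p.merge ⟨∅, ∅⟩ = p :=
  State.ext (union_empty _) (union_empty _)

theorem State.tokens_merge_dead (p : State V) (D : Finset V) :
    (p.merge ⟨∅, D⟩).tokens = p.tokens :=
  union_empty _

/-- A token is placed on a vertex that is not dead, or a token is removed and its vertex dies; at
least `t` tokens have to remain. -/
inductive Move (F : Set (Finset V)) (t : ℕ) : State V → State V → Prop
  | add {I D : Finset V} {v : V} (hI : v ∉ I) (hD : v ∉ D) (hF : insert v I ∈ F) (ht : t ≤ #I) :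
      Move F t ⟨I, D⟩ ⟨insert v I, D⟩
  | remove {I D : Finset V} {v : V} (hI : v ∉ I) (hF : insert v I ∈ F) (ht : t ≤ #I) :
      Move F t ⟨insert v I, D⟩ ⟨I, insert v D⟩

/-- Reachability by moves, along which every vertex receives a token at most once and loses it at
most once. -/
def Reach (F : Set (Finset V)) (t : ℕ) : State V → State V → Prop :=
  ReflTransGen (Move F t)

theorem Move.adj (hF : IsLowerSet F) {p q : State V} (h : Move F t p q) :
    Adj F t p.tokens q.tokens := by
  cases h with
  | add hI _ hmem ht =>
    exact ⟨⟨hF (subset_insert _ _) hmem, ht⟩, ⟨hmem, ht.trans (card_le_card (subset_insert _ _))⟩,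
      .inl (covBy_insert hI)⟩
  | remove hI hmem ht =>
    exact ⟨⟨hmem, ht.trans (card_le_card (subset_insert _ _))⟩, ⟨hF (subset_insert _ _) hmem, ht⟩,
      .inr (covBy_insert hI)⟩

theorem Move.disjoint {p q : State V} (h : Move F t p q) (hp : Disjoint p.tokens p.dead) :
    Disjoint q.tokens q.dead := by
  cases h with
  | add _ hD _ _ => exact disjoint_insert_left.2 ⟨hD, hp⟩
  | remove hI _ _ => exact disjoint_insert_right.2 ⟨hI, (disjoint_insert_left.1 hp).2⟩

theorem Move.card {p q : State V} (h : Move F t p q) (hp : Disjoint p.tokens p.dead) :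
    #q.tokens + 2 * #q.dead = #p.tokens + 2 * #p.dead + 1 := by
  cases h with
  | add hI _ _ _ =>
    rw [card_insert_of_notMem hI]
    ring
  | remove hI _ _ =>
    rw [card_insert_of_notMem hI, card_insert_of_notMem (disjoint_insert_left.1 hp).1]
    ring

theorem Move.mono (hF : F ⊆ F') (ht : t' ≤ t) {p q : State V} (h : Move F t p q) :
    Move F' t' p q := by
  cases h with
  | add hI hD hmem htI => exact .add hI hD (hF hmem) (ht.trans htI)
  | remove hI hmem htI => exact .remove hI (hF hmem) (ht.trans htI)

theorem Reach.mono (hF : F ⊆ F') (ht : t' ≤ t) {p q : State V} (h : Reach F t p q) :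
    Reach F' t' p q :=
  ReflTransGen.mono (fun _ _ hmove => hmove.mono hF ht) _ _ h

theorem Reach.conn (hF : IsLowerSet F) {p q : State V} (h : Reach F t p q) :
    Conn F t p.tokens q.tokens :=
  ReflTransGen.lift State.tokens (fun _ _ hmove => hmove.adj hF) _ _ h

theorem Reach.disjoint {p q : State V} (h : Reach F t p q) (hp : Disjoint p.tokens p.dead) :
    Disjoint q.tokens q.dead := by
  induction h with
  | refl => exact hp
  | tail _ hmove ih => exact hmove.disjoint ih

theorem Move.merge_right (hF : IsComplexOn F S) {p q r : State V} (h : Move F t p q)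
    (hr : Disjoint S ↑(r.tokens ∪ r.dead)) (hF' : ∀ I ∈ F, I ∪ r.tokens ∈ F')
    (ht : t' ≤ t + #r.tokens) : Move F' t' (p.merge r) (q.merge r) := by
  have notMem {I : Finset V} {v : V} (hmem : insert v I ∈ F) : v ∉ r.tokens ∧ v ∉ r.dead := by
    have := Set.disjoint_left.1 hr (hF.subset hmem (mem_insert_self v I))
    simpa only [coe_union, Set.mem_union, mem_coe, not_or] using this
  have le_card {I : Finset V} {v : V} (hmem : insert v I ∈ F) (hI : t ≤ #I) :
      t' ≤ #(I ∪ r.tokens) := by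
    have hIr : Disjoint (I : Set V) r.tokens :=
      hr.mono (hF.subset (hF.isLowerSet (subset_insert v I) hmem))
        (coe_subset.2 subset_union_left)
    rw [card_union_of_disjoint (disjoint_coe.1 hIr)]
    omega
  have insert_mem {I : Finset V} {v : V} (hmem : insert v I ∈ F) :
      insert v (I ∪ r.tokens) ∈ F' := by
    rw [← insert_union]
    exact hF' _ hmem
  cases h with
  | add hI hD hmem htI =>
    simp only [State.merge, insert_union]
    exact .add (notMem_union.2 ⟨hI, (notMem hmem).1⟩) (notMem_union.2 ⟨hD, (notMem hmem).2⟩)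
      (insert_mem hmem) (le_card hmem htI)
  | remove hI hmem htI =>
    simp only [State.merge, insert_union]
    exact .remove (notMem_union.2 ⟨hI, (notMem hmem).1⟩) (insert_mem hmem) (le_card hmem htI)

theorem Reach.merge_right (hF : IsComplexOn F S) {p q r : State V} (h : Reach F t p q)
    (hr : Disjoint S ↑(r.tokens ∪ r.dead)) (hF' : ∀ I ∈ F, I ∪ r.tokens ∈ F')
    (ht : t' ≤ t + #r.tokens) : Reach F' t' (p.merge r) (q.merge r) :=
  ReflTransGen.lift (fun p : State V => p.merge r)
    (fun _ _ hmove => hmove.merge_right hF hr hF' ht) _ _ h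

theorem reach_remove_all (hF : IsLowerSet F) {I : Finset V} (hI : I ∈ F) (D : Finset V) :
    Reach F 0 ⟨I, D⟩ ⟨∅, I ∪ D⟩ := by
  induction I using Finset.induction_on generalizing D with
  | empty => rw [empty_union]; exact .refl
  | insert v I hv ih =>
    rw [insert_union, ← union_insert]
    exact .head (.remove hv hI (Nat.zero_le _)) (ih (hF (subset_insert v I) hI) (insert v D))

omit [DecidableEq V] in
theorem conn_zero (hF : IsLowerSet F) {I J : Finset V} (hI : I ∈ F) (hJ : J ∈ F) :
    Conn F 0 I J := by
  classical
  exact ((reach_remove_all hF hI ∅).conn hF).trans ((reach_remove_all hF hJ ∅).conn hF).symm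

end Moves

section Settling

variable {V : Type*} [DecidableEq V] {F F₁ F₂ : Set (Finset V)} {S S₁ S₂ : Set V}
  {P P₁ P₂ : ℕ → State V → Prop}

/-- `P t p` is meant to say that the state `p` is settled at the threshold `t`: the tokens of `p`
form a largest set in their component, and the choice of that set depends on the component only.
Settled states can be reached from every set in `F`, at the threshold given by its cardinality, and
from every state that is settled at a higher threshold. -/
structure IsSettling (F : Set (Finset V)) (S : Set V) (P : ℕ → State V → Prop) : Prop where
  mem : ∀ {t p}, P t p → p.tokens ∈ F
  le_card : ∀ {t p}, P t p → t ≤ #p.tokens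
  dead_subset : ∀ {t p}, P t p → (p.dead : Set V) ⊆ S
  start : ∀ {A}, A ∈ F → ∃ p, P #A p ∧ Reach F #A ⟨A, ∅⟩ p
  lower : ∀ {t t' p}, P t p → t' ≤ t → ∃ q, P t' q ∧ Reach F t' p q
  max : ∀ {t p D}, P t p → Conn F t p.tokens D → #D ≤ #p.tokens
  unique : ∀ {t p q}, P t p → P t q → Conn F t p.tokens q.tokens → p.tokens = q.tokens

theorem IsSettling.exists_reach (hP : IsSettling F S P) {t : ℕ} {A : Finset V} (hA : A ∈ F)
    (ht : t ≤ #A) : ∃ p, P t p ∧ Reach F t ⟨A, ∅⟩ p := by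
  obtain ⟨p, hp, hAp⟩ := hP.start hA
  obtain ⟨q, hq, hpq⟩ := hP.lower hp ht
  exact ⟨q, hq, (hAp.mono subset_rfl ht).trans hpq⟩

theorem isSettling_Iic_singleton (v : V) :
    IsSettling (Set.Iic {v}) {v} fun t p => t ≤ 1 ∧ p = ⟨{v}, ∅⟩ where
  mem := by
    rintro t _ ⟨-, rfl⟩
    exact Set.self_mem_Iic
  le_card := by
    rintro t _ ⟨ht, rfl⟩
    exact ht
  dead_subset := by
    rintro t _ ⟨-, rfl⟩
    simp
  start {A} hA := by
    refine ⟨⟨{v}, ∅⟩, ⟨card_le_card hA, rfl⟩, ?_⟩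
    rcases subset_singleton_iff.1 hA with rfl | rfl
    · exact .single (.add (notMem_empty v) (notMem_empty v) Set.self_mem_Iic le_rfl)
    · exact .refl
  lower {_ _ p} hp ht := ⟨p, ⟨ht.trans hp.1, hp.2⟩, .refl⟩
  max := by
    rintro t _ D ⟨-, rfl⟩ hD
    exact card_le_card (hD.mem Set.self_mem_Iic)
  unique := by
    rintro t _ _ ⟨-, rfl⟩ ⟨-, rfl⟩ -
    rfl

/-- The states that are settled at `k` in the disjoint union of two graphs: each part is settled at
the least threshold that the tokens on the other part allow. -/
def SettledSups (P₁ P₂ : ℕ → State V → Prop) (k : ℕ) (p : State V) : Prop :=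
  ∃ p₁ p₂ : State V, P₁ (k - #p₂.tokens) p₁ ∧ P₂ (k - #p₁.tokens) p₂ ∧ p = p₁.merge p₂

theorem Reach.sups_left (h₁ : IsComplexOn F₁ S₁) (h₂ : IsComplexOn F₂ S₂)
    (hS : Disjoint S₁ S₂) {k t : ℕ} {p q r : State V} (h : Reach F₁ t p q) (hr : r.tokens ∈ F₂)
    (hr' : (r.dead : Set V) ⊆ S₂) (hk : k ≤ t + #r.tokens) :
    Reach (F₁ ⊻ F₂) k (p.merge r) (q.merge r) := by
  refine h.merge_right h₁ (hS.mono_right ?_) (fun I hI => Set.mem_sups.2 ⟨I, hI, _, hr, rfl⟩) hk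
  rw [coe_union]
  exact Set.union_subset (h₂.subset hr) hr'

theorem Reach.sups_right (h₁ : IsComplexOn F₁ S₁) (h₂ : IsComplexOn F₂ S₂)
    (hS : Disjoint S₁ S₂) {k t : ℕ} {p q r : State V} (h : Reach F₂ t p q) (hr : r.tokens ∈ F₁)
    (hr' : (r.dead : Set V) ⊆ S₁) (hk : k ≤ t + #r.tokens) :
    Reach (F₁ ⊻ F₂) k (r.merge p) (r.merge q) := by
  rw [r.merge_comm p, r.merge_comm q, Set.sups_comm]
  exact h.sups_left h₂ h₁ hS.symm hr hr' hk

/-- Lowering the threshold of one part does not decrease its number of tokens, so the other part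
may keep its threshold; hence the parts can be lowered in turns. -/
theorem IsSettling.exists_settledSups (h₁ : IsComplexOn F₁ S₁) (h₂ : IsComplexOn F₂ S₂)
    (hS : Disjoint S₁ S₂) (hP₁ : IsSettling F₁ S₁ P₁) (hP₂ : IsSettling F₂ S₂ P₂)
    {k a b : ℕ} {p₁ p₂ : State V} (hp₁ : P₁ a p₁) (hp₂ : P₂ b p₂) (ha : k - #p₂.tokens ≤ a)
    (hb : k - #p₁.tokens ≤ b) :
    ∃ q, SettledSups P₁ P₂ k q ∧ Reach (F₁ ⊻ F₂) k (p₁.merge p₂) q := by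
  induction hn : a + b using Nat.strong_induction_on generalizing a b p₁ p₂ with
  | _ n ih =>
    subst hn
    rcases ha.lt_or_eq with ha' | rfl
    · obtain ⟨q₁, hq₁, hpq₁⟩ := hP₁.lower hp₁ ha
      have hcard : #p₁.tokens ≤ #q₁.tokens := hP₁.max hq₁ (hpq₁.conn h₁.isLowerSet).symm
      obtain ⟨q, hq, hreach⟩ := ih _ (by omega) hq₁ hp₂ le_rfl (by omega) rfl
      exact ⟨q, hq, (hpq₁.sups_left h₁ h₂ hS (hP₂.mem hp₂) (hP₂.dead_subset hp₂)
        (by omega)).trans hreach⟩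
    rcases hb.lt_or_eq with hb' | rfl
    · obtain ⟨q₂, hq₂, hpq₂⟩ := hP₂.lower hp₂ hb
      have hcard : #p₂.tokens ≤ #q₂.tokens := hP₂.max hq₂ (hpq₂.conn h₂.isLowerSet).symm
      obtain ⟨q, hq, hreach⟩ := ih _ (by omega) hp₁ hq₂ (by omega) le_rfl rfl
      exact ⟨q, hq, (hpq₂.sups_right h₁ h₂ hS (hP₁.mem hp₁) (hP₁.dead_subset hp₁)
        (by omega)).trans hreach⟩
    exact ⟨_, ⟨p₁, p₂, hp₁, hp₂, rfl⟩, .refl⟩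

theorem IsSettling.exists_settledSups_start (h₁ : IsComplexOn F₁ S₁) (h₂ : IsComplexOn F₂ S₂)
    (hS : Disjoint S₁ S₂) (hP₁ : IsSettling F₁ S₁ P₁) (hP₂ : IsSettling F₂ S₂ P₂)
    {A : Finset V} (hA : A ∈ F₁ ⊻ F₂) :
    ∃ p, SettledSups P₁ P₂ #A p ∧ Reach (F₁ ⊻ F₂) #A ⟨A, ∅⟩ p := by
  obtain ⟨A₁, hA₁, A₂, hA₂, rfl : A₁ ∪ A₂ = A⟩ := hA
  obtain ⟨p₁, hp₁, hreach₁⟩ := hP₁.start hA₁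
  obtain ⟨p₂, hp₂, hreach₂⟩ := hP₂.start hA₂
  have hcard : #(A₁ ∪ A₂) = #A₁ + #A₂ := card_union_of_disjoint (h₁.disjoint h₂ hS hA₁ hA₂)
  have hle₁ : #A₁ ≤ #p₁.tokens := hP₁.le_card hp₁
  have hle₂ : #A₂ ≤ #p₂.tokens := hP₂.le_card hp₂
  obtain ⟨q, hq, hreach⟩ := exists_settledSups (k := #(A₁ ∪ A₂)) h₁ h₂ hS hP₁ hP₂ hp₁ hp₂
    (by omega) (by omega)
  have hreachA₁ : Reach (F₁ ⊻ F₂) #(A₁ ∪ A₂) (.merge ⟨A₁, ∅⟩ ⟨A₂, ∅⟩) (p₁.merge ⟨A₂, ∅⟩) :=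
    hreach₁.sups_left h₁ h₂ hS hA₂ (coe_empty.trans_subset (Set.empty_subset _)) hcard.le
  have hreachA₂ : Reach (F₁ ⊻ F₂) #(A₁ ∪ A₂) (p₁.merge ⟨A₂, ∅⟩) (p₁.merge p₂) :=
    hreach₂.sups_right h₁ h₂ hS (hP₁.mem hp₁) (hP₁.dead_subset hp₁) (by omega)
  exact ⟨q, hq, hreachA₁.trans (hreachA₂.trans hreach)⟩

theorem SettledSups.conn (h₁ : IsComplexOn F₁ S₁) (h₂ : IsComplexOn F₂ S₂)
    (hS : Disjoint S₁ S₂) (hP₁ : IsSettling F₁ S₁ P₁) (hP₂ : IsSettling F₂ S₂ P₂) {k : ℕ}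
    {p₁ p₂ : State V} (hp₁ : P₁ (k - #p₂.tokens) p₁) (hp₂ : P₂ (k - #p₁.tokens) p₂)
    {D₁ D₂ : Finset V} (hD₁ : D₁ ∈ F₁) (hD₂ : D₂ ∈ F₂)
    (h : Conn (F₁ ⊻ F₂) k (p₁.merge p₂).tokens (D₁ ∪ D₂)) :
    Conn F₁ (k - #p₂.tokens) p₁.tokens D₁ ∧ Conn F₂ (k - #p₁.tokens) p₂.tokens D₂ :=
  h.of_sups h₁ h₂ hS (hP₁.mem hp₁) (hP₂.mem hp₂) (fun _ => hP₁.max hp₁) (fun _ => hP₂.max hp₂)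
    hD₁ hD₂

theorem IsSettling.sups (h₁ : IsComplexOn F₁ S₁) (h₂ : IsComplexOn F₂ S₂) (hS : Disjoint S₁ S₂)
    (hP₁ : IsSettling F₁ S₁ P₁) (hP₂ : IsSettling F₂ S₂ P₂) :
    IsSettling (F₁ ⊻ F₂) (S₁ ∪ S₂) (SettledSups P₁ P₂) where
  mem := by
    rintro k _ ⟨p₁, p₂, hp₁, hp₂, rfl⟩
    exact Set.mem_sups.2 ⟨_, hP₁.mem hp₁, _, hP₂.mem hp₂, rfl⟩
  le_card := by
    rintro k _ ⟨p₁, p₂, hp₁, hp₂, rfl⟩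
    have hcard : #(p₁.merge p₂).tokens = #p₁.tokens + #p₂.tokens :=
      card_union_of_disjoint (h₁.disjoint h₂ hS (hP₁.mem hp₁) (hP₂.mem hp₂))
    have := hP₁.le_card hp₁
    omega
  dead_subset := by
    rintro k _ ⟨p₁, p₂, hp₁, hp₂, rfl⟩
    exact (coe_union _ _).subset.trans
      (Set.union_subset_union (hP₁.dead_subset hp₁) (hP₂.dead_subset hp₂))
  start := exists_settledSups_start h₁ h₂ hS hP₁ hP₂
  lower := by
    rintro k k' _ ⟨p₁, p₂, hp₁, hp₂, rfl⟩ hk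
    exact exists_settledSups h₁ h₂ hS hP₁ hP₂ hp₁ hp₂ (by omega) (by omega)
  max := by
    rintro k _ D ⟨p₁, p₂, hp₁, hp₂, rfl⟩ hconn
    have hmem := hconn.mem (Set.mem_sups.2 ⟨_, hP₁.mem hp₁, _, hP₂.mem hp₂, rfl⟩)
    obtain ⟨D₁, hD₁, D₂, hD₂, rfl⟩ := hmem
    obtain ⟨hconn₁, hconn₂⟩ := SettledSups.conn h₁ h₂ hS hP₁ hP₂ hp₁ hp₂ hD₁ hD₂ hconn
    calc #(D₁ ∪ D₂) ≤ #D₁ + #D₂ := card_union_le _ _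
      _ ≤ #p₁.tokens + #p₂.tokens := add_le_add (hP₁.max hp₁ hconn₁) (hP₂.max hp₂ hconn₂)
      _ = #(p₁.merge p₂).tokens :=
        (card_union_of_disjoint (h₁.disjoint h₂ hS (hP₁.mem hp₁) (hP₂.mem hp₂))).symm
  unique := by
    rintro k _ _ ⟨p₁, p₂, hp₁, hp₂, rfl⟩ ⟨q₁, q₂, hq₁, hq₂, rfl⟩ hconn
    obtain ⟨hpq₁, hpq₂⟩ :=
      SettledSups.conn h₁ h₂ hS hP₁ hP₂ hp₁ hp₂ (hP₁.mem hq₁) (hP₂.mem hq₂) hconn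
    obtain ⟨hqp₁, hqp₂⟩ :=
      SettledSups.conn h₁ h₂ hS hP₁ hP₂ hq₁ hq₂ (hP₁.mem hp₁) (hP₂.mem hp₂) hconn.symm
    have hcard₁ : #q₁.tokens = #p₁.tokens := (hP₁.max hp₁ hpq₁).antisymm (hP₁.max hq₁ hqp₁)
    have hcard₂ : #q₂.tokens = #p₂.tokens := (hP₂.max hp₂ hpq₂).antisymm (hP₂.max hq₂ hqp₂)
    exact congrArg₂ (· ∪ ·) (hP₁.unique hp₁ (hcard₂ ▸ hq₁) hpq₁)
      (hP₂.unique hp₂ (hcard₁ ▸ hq₂) hpq₂)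

/-- The states that are settled at `t` in the join of two graphs, of which the first has the larger
independent sets: a positive threshold confines the tokens to one part; without a threshold, they
settle on the first part, and the vertices of the second may have died. -/
def SettledUnion (S₂ : Set V) (P₁ P₂ : ℕ → State V → Prop) (t : ℕ) (p : State V) : Prop :=
  0 < t ∧ (P₁ t p ∨ P₂ t p) ∨
    t = 0 ∧ ∃ (p₁ : State V) (D : Finset V), P₁ 0 p₁ ∧ (D : Set V) ⊆ S₂ ∧ p = p₁.merge ⟨∅, D⟩

theorem SettledUnion.mk_zero {p : State V} (hp : P₁ 0 p) : SettledUnion S₂ P₁ P₂ 0 p :=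
  .inr ⟨rfl, p, ∅, hp, coe_empty.trans_subset (Set.empty_subset _), p.merge_empty.symm⟩

theorem IsSettling.exists_settledUnion_zero (h₁ : IsComplexOn F₁ S₁) (h₂ : IsComplexOn F₂ S₂)
    (hS : Disjoint S₁ S₂) (hP₁ : IsSettling F₁ S₁ P₁) (hP₂ : IsSettling F₂ S₂ P₂) {t : ℕ}
    {p : State V} (hp : P₂ t p) :
    ∃ q, SettledUnion S₂ P₁ P₂ 0 q ∧ Reach (F₁ ∪ F₂) 0 p q := by
  obtain ⟨p₁, hp₁, hreach₁⟩ := hP₁.start h₁.empty_mem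
  have hdead : ((p.tokens ∪ p.dead : Finset V) : Set V) ⊆ S₂ := by
    rw [coe_union]
    exact Set.union_subset (h₂.subset (hP₂.mem hp)) (hP₂.dead_subset hp)
  have hremove : Reach (F₁ ∪ F₂) 0 p ⟨∅, p.tokens ∪ p.dead⟩ :=
    (reach_remove_all h₂.isLowerSet (hP₂.mem hp) p.dead).mono Set.subset_union_right le_rfl
  have hmerge : Reach (F₁ ∪ F₂) 0 (.merge ⟨∅, ∅⟩ ⟨∅, p.tokens ∪ p.dead⟩)
      (p₁.merge ⟨∅, p.tokens ∪ p.dead⟩) := by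
    refine hreach₁.merge_right h₁ (hS.mono_right ?_) (fun I hI => ?_) (Nat.zero_le _)
    · simpa only [empty_union] using hdead
    · simpa only [union_empty] using Set.mem_union_left F₂ hI
  rw [State.merge_comm ⟨∅, ∅⟩, State.merge_empty] at hmerge
  exact ⟨_, .inr ⟨rfl, p₁, _, hp₁, hdead, rfl⟩, hremove.trans hmerge⟩

theorem IsSettling.exists_settledUnion_start (h₁ : IsComplexOn F₁ S₁) (hP₁ : IsSettling F₁ S₁ P₁)
    (hP₂ : IsSettling F₂ S₂ P₂) {A : Finset V} (hA : A ∈ F₁ ∪ F₂) :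
    ∃ p, SettledUnion S₂ P₁ P₂ #A p ∧ Reach (F₁ ∪ F₂) #A ⟨A, ∅⟩ p := by
  rcases A.eq_empty_or_nonempty with rfl | hne
  · obtain ⟨p, hp, hreach⟩ := hP₁.start h₁.empty_mem
    exact ⟨p, .mk_zero hp, hreach.mono Set.subset_union_left le_rfl⟩
  rcases hA with hA | hA
  · obtain ⟨p, hp, hreach⟩ := hP₁.start hA
    exact ⟨p, .inl ⟨hne.card_pos, .inl hp⟩, hreach.mono Set.subset_union_left le_rfl⟩
  · obtain ⟨p, hp, hreach⟩ := hP₂.start hA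
    exact ⟨p, .inl ⟨hne.card_pos, .inr hp⟩, hreach.mono Set.subset_union_right le_rfl⟩

theorem IsSettling.exists_settledUnion_lower (h₁ : IsComplexOn F₁ S₁) (h₂ : IsComplexOn F₂ S₂)
    (hS : Disjoint S₁ S₂) (hP₁ : IsSettling F₁ S₁ P₁) (hP₂ : IsSettling F₂ S₂ P₂) {t t' : ℕ}
    {p : State V} (hp : SettledUnion S₂ P₁ P₂ t p) (ht' : t' ≤ t) :
    ∃ q, SettledUnion S₂ P₁ P₂ t' q ∧ Reach (F₁ ∪ F₂) t' p q := by
  rcases hp with ⟨-, hp₁ | hp₂⟩ | ⟨rfl, hp⟩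
  · obtain ⟨q, hq, hreach⟩ := hP₁.lower hp₁ ht'
    refine ⟨q, ?_, hreach.mono Set.subset_union_left le_rfl⟩
    rcases t'.eq_zero_or_pos with rfl | hpos
    · exact .mk_zero hq
    · exact .inl ⟨hpos, .inl hq⟩
  · rcases t'.eq_zero_or_pos with rfl | hpos
    · exact hP₁.exists_settledUnion_zero h₁ h₂ hS hP₂ hp₂
    · obtain ⟨q, hq, hreach⟩ := hP₂.lower hp₂ ht'
      exact ⟨q, .inl ⟨hpos, .inr hq⟩, hreach.mono Set.subset_union_right le_rfl⟩
  · obtain rfl := Nat.le_zero.1 ht'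
    exact ⟨p, .inr ⟨rfl, hp⟩, .refl⟩

theorem IsSettling.card_le_of_settledUnion (h₁ : IsComplexOn F₁ S₁) (h₂ : IsComplexOn F₂ S₂)
    (hS : Disjoint S₁ S₂) (hP₁ : IsSettling F₁ S₁ P₁) (hP₂ : IsSettling F₂ S₂ P₂)
    (hle : ∀ J ∈ F₂, ∃ I ∈ F₁, #J ≤ #I) {t : ℕ} {p : State V} {D : Finset V}
    (hp : SettledUnion S₂ P₁ P₂ t p) (h : Conn (F₁ ∪ F₂) t p.tokens D) : #D ≤ #p.tokens := by
  rcases hp with ⟨ht, hp | hp⟩ | ⟨rfl, p₁, D', hp₁, -, rfl⟩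
  · exact hP₁.max hp (h.of_union_left h₁ h₂ hS ht (hP₁.mem hp))
  · exact hP₂.max hp (h.of_union_right h₁ h₂ hS ht (hP₂.mem hp))
  · rw [State.tokens_merge_dead] at h ⊢
    have card_le {I : Finset V} (hI : I ∈ F₁) : #I ≤ #p₁.tokens :=
      hP₁.max hp₁ (conn_zero h₁.isLowerSet (hP₁.mem hp₁) hI)
    rcases h.mem (.inl (hP₁.mem hp₁)) with hD | hD
    · exact card_le hD
    · obtain ⟨I, hI, hDI⟩ := hle D hD
      exact hDI.trans (card_le hI)

theorem IsSettling.tokens_eq_of_settledUnion (h₁ : IsComplexOn F₁ S₁) (h₂ : IsComplexOn F₂ S₂)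
    (hS : Disjoint S₁ S₂) (hP₁ : IsSettling F₁ S₁ P₁) (hP₂ : IsSettling F₂ S₂ P₂) {t : ℕ}
    {p q : State V} (hp : SettledUnion S₂ P₁ P₂ t p) (hq : SettledUnion S₂ P₁ P₂ t q)
    (h : Conn (F₁ ∪ F₂) t p.tokens q.tokens) : p.tokens = q.tokens := by
  rcases hp with ⟨ht, hp⟩ | ⟨rfl, p₁, D, hp₁, -, rfl⟩
  · replace hq : P₁ t q ∨ P₂ t q := hq.elim And.right fun hq => absurd hq.1 ht.ne'
    rcases hp with hp | hp <;> rcases hq with hq | hq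
    · exact hP₁.unique hp hq (h.of_union_left h₁ h₂ hS ht (hP₁.mem hp))
    · exact (not_conn_union h₁ h₂ hS ht (hP₁.mem hp) (hP₂.mem hq) (hP₂.le_card hq) h).elim
    · exact (not_conn_union h₁ h₂ hS ht (hP₁.mem hq) (hP₂.mem hp) (hP₂.le_card hp) h.symm).elim
    · exact hP₂.unique hp hq (h.of_union_right h₁ h₂ hS ht (hP₂.mem hp))
  · obtain ⟨hlt, -⟩ | ⟨-, q₁, E, hq₁, -, rfl⟩ := hq
    · exact absurd hlt (lt_irrefl 0)
    simp only [State.tokens_merge_dead]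
    exact hP₁.unique hp₁ hq₁ (conn_zero h₁.isLowerSet (hP₁.mem hp₁) (hP₁.mem hq₁))

theorem IsSettling.union (h₁ : IsComplexOn F₁ S₁) (h₂ : IsComplexOn F₂ S₂) (hS : Disjoint S₁ S₂)
    (hP₁ : IsSettling F₁ S₁ P₁) (hP₂ : IsSettling F₂ S₂ P₂)
    (hle : ∀ J ∈ F₂, ∃ I ∈ F₁, #J ≤ #I) :
    IsSettling (F₁ ∪ F₂) (S₁ ∪ S₂) (SettledUnion S₂ P₁ P₂) where
  mem := by
    rintro t p (⟨-, hp | hp⟩ | ⟨-, p₁, D, hp₁, -, rfl⟩)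
    · exact .inl (hP₁.mem hp)
    · exact .inr (hP₂.mem hp)
    · rw [State.tokens_merge_dead]
      exact .inl (hP₁.mem hp₁)
  le_card := by
    rintro t p (⟨-, hp | hp⟩ | ⟨rfl, -⟩)
    · exact hP₁.le_card hp
    · exact hP₂.le_card hp
    · exact Nat.zero_le _
  dead_subset := by
    rintro t p (⟨-, hp | hp⟩ | ⟨-, p₁, D, hp₁, hD, rfl⟩)
    · exact (hP₁.dead_subset hp).trans Set.subset_union_left
    · exact (hP₂.dead_subset hp).trans Set.subset_union_right
    · exact (coe_union _ _).subset.trans (Set.union_subset_union (hP₁.dead_subset hp₁) hD)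
  start := hP₁.exists_settledUnion_start h₁ hP₂
  lower := hP₁.exists_settledUnion_lower h₁ h₂ hS hP₂
  max := hP₁.card_le_of_settledUnion h₁ h₂ hS hP₂ hle
  unique := hP₁.tokens_eq_of_settledUnion h₁ h₂ hS hP₂

end Settling

section Graphs

open SimpleGraph

variable {V : Type*} {G G₁ G₂ : SimpleGraph V} {S S₁ S₂ : Set V}

theorem isIndepSet_sup {s : Set V} :
    (G₁ ⊔ G₂).IsIndepSet s ↔ G₁.IsIndepSet s ∧ G₂.IsIndepSet s := by
  simp only [isIndepSet_iff, Set.Pairwise, sup_adj, not_or, imp_and, forall_and]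

theorem isIndepSet_of_inter (hG : G.support ⊆ S) {s : Set V} (h : G.IsIndepSet (s ∩ S)) :
    G.IsIndepSet s := fun x hx y hy hne hxy =>
  h ⟨hx, hG ⟨y, hxy⟩⟩ ⟨hy, hG ⟨x, hxy.symm⟩⟩ hne hxy

/-- The independent sets of the subgraph of `G` induced on `S`, as sets of vertices of `G`. -/
def indepSetsIn (G : SimpleGraph V) (S : Set V) : Set (Finset V) :=
  {I | (I : Set V) ⊆ S ∧ G.IsIndepSet I}

theorem isComplexOn_indepSetsIn (G : SimpleGraph V) (S : Set V) :
    IsComplexOn (indepSetsIn G S) S where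
  empty_mem := ⟨coe_empty.trans_subset (Set.empty_subset _), by simp⟩
  isLowerSet _ _ hJI hI := ⟨(coe_subset.2 hJI).trans hI.1, hI.2.mono (coe_subset.2 hJI)⟩
  subset _ hI := hI.1

theorem indepSetsIn_bot_singleton (v : V) : indepSetsIn ⊥ {v} = Set.Iic {v} := by
  ext I
  have hbot : (⊥ : SimpleGraph V).IsIndepSet I := fun _ _ _ _ _ hxy => hxy
  have hsub : (I : Set V) ⊆ {v} ↔ I ⊆ {v} := by rw [← coe_singleton, coe_subset]
  exact (and_iff_left hbot).trans hsub

theorem indepSetsIn_sup [DecidableEq V] (hG₁ : G₁.support ⊆ S₁) (hG₂ : G₂.support ⊆ S₂)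
    (hS : Disjoint S₁ S₂) :
    indepSetsIn (G₁ ⊔ G₂) (S₁ ∪ S₂) = indepSetsIn G₁ S₁ ⊻ indepSetsIn G₂ S₂ := by
  classical
  ext I
  constructor
  · rintro ⟨hIS, hI⟩
    obtain ⟨hI₁, hI₂⟩ := isIndepSet_sup.1 hI
    refine ⟨{x ∈ I | x ∈ S₁}, ⟨fun x hx => (mem_filter.1 hx).2, hI₁.mono (filter_subset _ _)⟩,
      {x ∈ I | x ∈ S₂}, ⟨fun x hx => (mem_filter.1 hx).2, hI₂.mono (filter_subset _ _)⟩, ?_⟩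
    exact (filter_or _ _ I).symm.trans (filter_true_of_mem hIS)
  · rintro ⟨I₁, ⟨hIS₁, hI₁⟩, I₂, ⟨hIS₂, hI₂⟩, rfl : I₁ ∪ I₂ = I⟩
    refine ⟨(coe_union I₁ I₂).trans_subset (Set.union_subset_union hIS₁ hIS₂),
      isIndepSet_sup.2 ⟨isIndepSet_of_inter hG₁ (hI₁.mono ?_),
        isIndepSet_of_inter hG₂ (hI₂.mono ?_)⟩⟩
    · rw [coe_union, Set.union_inter_distrib_right, (hS.symm.mono_left hIS₂).inter_eq,
        Set.union_empty]
      exact Set.inter_subset_left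
    · rw [coe_union, Set.union_inter_distrib_right, (hS.mono_left hIS₁).inter_eq,
        Set.empty_union]
      exact Set.inter_subset_left

theorem isIndepSet_fromRel (hS : Disjoint S₁ S₂) {s : Set V} (hs : s ⊆ S₁ ∪ S₂) :
    (fromRel fun x y => x ∈ S₁ ∧ y ∈ S₂).IsIndepSet s ↔ s ⊆ S₁ ∨ s ⊆ S₂ := by
  constructor
  · intro h
    by_contra! hcon
    obtain ⟨⟨x, hx, hx₁⟩, y, hy, hy₂⟩ := hcon.imp Set.not_subset.1 Set.not_subset.1
    have hx₂ : x ∈ S₂ := (hs hx).resolve_left hx₁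
    have hy₁ : y ∈ S₁ := (hs hy).resolve_right hy₂
    exact h hx hy (ne_of_mem_of_not_mem hx₂ hy₂) ⟨ne_of_mem_of_not_mem hx₂ hy₂, .inr ⟨hy₁, hx₂⟩⟩
  · rintro (h | h) x hx y hy - ⟨-, hxy | hyx⟩
    · exact Set.disjoint_left.1 hS (h hy) hxy.2
    · exact Set.disjoint_left.1 hS (h hx) hyx.2
    · exact Set.disjoint_left.1 hS hxy.1 (h hx)
    · exact Set.disjoint_left.1 hS hyx.1 (h hy)

theorem indepSetsIn_join (hG₁ : G₁.support ⊆ S₁) (hG₂ : G₂.support ⊆ S₂) (hS : Disjoint S₁ S₂) :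
    indepSetsIn (G₁ ⊔ G₂ ⊔ fromRel fun x y => x ∈ S₁ ∧ y ∈ S₂) (S₁ ∪ S₂) =
      indepSetsIn G₁ S₁ ∪ indepSetsIn G₂ S₂ := by
  ext I
  constructor
  · rintro ⟨hIS, hI⟩
    obtain ⟨hI, hIjoin⟩ := isIndepSet_sup.1 hI
    obtain ⟨hI₁, hI₂⟩ := isIndepSet_sup.1 hI
    exact ((isIndepSet_fromRel hS hIS).1 hIjoin).imp (⟨·, hI₁⟩) (⟨·, hI₂⟩)
  · rintro (⟨hIS, hI⟩ | ⟨hIS, hI⟩)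
    · have hI₂ : G₂.IsIndepSet I := isIndepSet_of_inter hG₂ (by simp [(hS.mono_left hIS).inter_eq])
      have hIS' : (I : Set V) ⊆ S₁ ∪ S₂ := hIS.trans Set.subset_union_left
      exact ⟨hIS', isIndepSet_sup.2
        ⟨isIndepSet_sup.2 ⟨hI, hI₂⟩, (isIndepSet_fromRel hS hIS').2 (.inl hIS)⟩⟩
    · have hI₁ : G₁.IsIndepSet I :=
        isIndepSet_of_inter hG₁ (by simp [(hS.symm.mono_left hIS).inter_eq])
      have hIS' : (I : Set V) ⊆ S₁ ∪ S₂ := hIS.trans Set.subset_union_right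
      exact ⟨hIS', isIndepSet_sup.2
        ⟨isIndepSet_sup.2 ⟨hI₁, hI⟩, (isIndepSet_fromRel hS hIS').2 (.inr hIS)⟩⟩

theorem support_graph_subset_verts (T : Cotree V) : T.graph.support ⊆ T.verts := by
  induction T with
  | leaf v => exact support_bot.trans_subset (Set.empty_subset _)
  | union l r ihl ihr =>
    rintro x ⟨y, hxy | hxy⟩
    · exact .inl (ihl ⟨y, hxy⟩)
    · exact .inr (ihr ⟨y, hxy⟩)
  | join l r ihl ihr =>
    rintro x ⟨y, (hxy | hxy) | ⟨-, hxy | hyx⟩⟩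
    · exact .inl (ihl ⟨y, hxy⟩)
    · exact .inr (ihr ⟨y, hxy⟩)
    · exact .inl hxy.1
    · exact .inr hyx.2

theorem exists_isSettling_union [DecidableEq V] {F₁ F₂ : Set (Finset V)}
    (h₁ : IsComplexOn F₁ S₁) (h₂ : IsComplexOn F₂ S₂) (hS : Disjoint S₁ S₂)
    (hP₁ : ∃ P, IsSettling F₁ S₁ P) (hP₂ : ∃ P, IsSettling F₂ S₂ P) :
    ∃ P, IsSettling (F₁ ∪ F₂) (S₁ ∪ S₂) P := by
  obtain ⟨P₁, hP₁⟩ := hP₁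
  obtain ⟨P₂, hP₂⟩ := hP₂
  by_cases hle : ∀ J ∈ F₂, ∃ I ∈ F₁, #J ≤ #I
  · exact ⟨_, hP₁.union h₁ h₂ hS hP₂ hle⟩
  · push Not at hle
    obtain ⟨J, hJ, hJlt⟩ := hle
    rw [Set.union_comm F₁, Set.union_comm S₁]
    exact ⟨_, hP₂.union h₂ h₁ hS.symm hP₁ fun I hI => ⟨J, hJ, (hJlt I hI).le⟩⟩

theorem exists_isSettling_cotree [DecidableEq V] (T : Cotree V) (hT : T.WellFormed) :
    ∃ P, IsSettling (indepSetsIn T.graph T.verts) T.verts P := by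
  induction T with
  | leaf v => exact ⟨_, (indepSetsIn_bot_singleton v).symm ▸ isSettling_Iic_singleton v⟩
  | union l r ihl ihr =>
    obtain ⟨hl, hr, hS⟩ := hT
    obtain ⟨Pl, hPl⟩ := ihl hl
    obtain ⟨Pr, hPr⟩ := ihr hr
    simp only [Cotree.graph, Cotree.verts, indepSetsIn_sup (support_graph_subset_verts l)
      (support_graph_subset_verts r) hS]
    exact ⟨_, hPl.sups (isComplexOn_indepSetsIn _ _) (isComplexOn_indepSetsIn _ _) hS hPr⟩
  | join l r ihl ihr =>
    obtain ⟨hl, hr, hS⟩ := hT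
    simp only [Cotree.graph, Cotree.verts, indepSetsIn_join (support_graph_subset_verts l)
      (support_graph_subset_verts r) hS]
    exact exists_isSettling_union (isComplexOn_indepSetsIn _ _) (isComplexOn_indepSetsIn _ _) hS
      (ihl hl) (ihr hr)

end Graphs

section Walks

variable {V : Type*} [DecidableEq V] {G : SimpleGraph V} {k : ℤ}

theorem tarStep_iff_covBy {I J : Finset V} : TARStep I J ↔ I ⋖ J ∨ J ⋖ I := by
  simp only [TARStep, union_singleton, covBy_iff_exists_insert]
  constructor
  · rintro ⟨hne, v, rfl | rfl⟩
    · exact .inl ⟨v, fun hv => hne (insert_eq_of_mem hv).symm, rfl⟩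
    · exact .inr ⟨v, fun hv => hne (insert_eq_of_mem hv), rfl⟩
  · rintro (⟨v, hv, rfl⟩ | ⟨v, hv, rfl⟩)
    · exact ⟨(ssubset_insert hv).ne, v, .inl rfl⟩
    · exact ⟨(ssubset_insert hv).ne', v, .inr rfl⟩

theorem conn_of_reachable {A B : {I : Finset V // G.IsIndepSet (I : Set V) ∧ k ≤ (#I : ℤ)}}
    (h : (TARGraph G k).Reachable A B) : Conn (indepSetsIn G Set.univ) k.toNat A.1 B.1 := by
  have mem (I : {I : Finset V // G.IsIndepSet (I : Set V) ∧ k ≤ (#I : ℤ)}) :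
      I.1 ∈ indepSetsIn G Set.univ ∧ k.toNat ≤ #I.1 :=
    ⟨⟨Set.subset_univ _, I.2.1⟩, Int.toNat_le.2 I.2.2⟩
  exact ReflTransGen.lift Subtype.val (fun I J hIJ => ⟨mem I, mem J, tarStep_iff_covBy.1 hIJ⟩) _ _
    ((SimpleGraph.reachable_iff_reflTransGen A B).1 h)

theorem Reach.exists_walk {p q : State V} (h : Reach (indepSetsIn G Set.univ) k.toNat p q)
    (hp : Disjoint p.tokens p.dead)
    (hpk : G.IsIndepSet (p.tokens : Set V) ∧ k ≤ (#p.tokens : ℤ)) :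
    ∃ (hqk : G.IsIndepSet (q.tokens : Set V) ∧ k ≤ (#q.tokens : ℤ))
      (w : (TARGraph G k).Walk ⟨p.tokens, hpk⟩ ⟨q.tokens, hqk⟩),
      w.length + #p.tokens + 2 * #p.dead = #q.tokens + 2 * #q.dead := by
  induction h with
  | refl => exact ⟨hpk, .nil, by simp⟩
  | @tail q r hreach hmove ih =>
    obtain ⟨hqk, w, hw⟩ := ih
    obtain ⟨-, ⟨⟨-, hindep⟩, hcard⟩, hcovBy⟩ :=
      hmove.adj (isComplexOn_indepSetsIn G Set.univ).isLowerSet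
    have hadj : (TARGraph G k).Adj ⟨q.tokens, hqk⟩ ⟨r.tokens, hindep, Int.toNat_le.1 hcard⟩ :=
      tarStep_iff_covBy.2 hcovBy
    refine ⟨_, w.concat hadj, ?_⟩
    have hmove_card := hmove.card (Reach.disjoint hreach hp)
    rw [SimpleGraph.Walk.length_concat]
    omega

omit [DecidableEq V] in
theorem card_tokens_add_card_dead_le [Fintype V] {p : State V} (hp : Disjoint p.tokens p.dead) :
    #p.tokens + #p.dead ≤ Fintype.card V := by
  classical
  rw [← card_union_of_disjoint hp]
  exact card_le_univ _

theorem isTARSequence_getVert {A B : {I : Finset V // G.IsIndepSet (I : Set V) ∧ k ≤ (#I : ℤ)}}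
    (w : (TARGraph G k).Walk A B) :
    IsTARSequence G k A.1 B.1 w.length fun i => (w.getVert i).1 where
  start := by rw [w.getVert_zero]
  finish := by rw [w.getVert_length]
  indep i _ := (w.getVert i).2.1
  card_ge i _ := (w.getVert i).2.2
  step _ hi := .inr (w.adj_getVert_succ hi)

theorem IsSettling.exists_walk [Fintype V] {P : ℕ → State V → Prop}
    (hP : IsSettling (indepSetsIn G Set.univ) Set.univ P)
    (A : {I : Finset V // G.IsIndepSet (I : Set V) ∧ k ≤ (#I : ℤ)}) :
    ∃ (p : State V) (hp : G.IsIndepSet (p.tokens : Set V) ∧ k ≤ (#p.tokens : ℤ))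
      (w : (TARGraph G k).Walk A ⟨p.tokens, hp⟩),
      P k.toNat p ∧ w.length + #A.1 + #p.tokens ≤ 2 * Fintype.card V := by
  obtain ⟨p, hPp, hreach⟩ :=
    hP.exists_reach ⟨Set.subset_univ _, A.2.1⟩ (Int.toNat_le.2 A.2.2)
  obtain ⟨hp, w, hw : w.length + #A.1 = #p.tokens + 2 * #p.dead⟩ :=
    hreach.exists_walk (disjoint_empty_right A.1) A.2
  have hcard := card_tokens_add_card_dead_le (hreach.disjoint (disjoint_empty_right A.1))
  exact ⟨p, hp, w, hPp, by omega⟩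

theorem IsSettling.exists_walk_of_reachable [Fintype V] {P : ℕ → State V → Prop}
    (hP : IsSettling (indepSetsIn G Set.univ) Set.univ P)
    {A B : {I : Finset V // G.IsIndepSet (I : Set V) ∧ k ≤ (#I : ℤ)}}
    (h : (TARGraph G k).Reachable A B) :
    ∃ w : (TARGraph G k).Walk A B, w.length + #A.1 + #B.1 ≤ 4 * Fintype.card V := by
  obtain ⟨p, hp, wA, hPp, hwA⟩ := hP.exists_walk A
  obtain ⟨q, hq, wB, hPq, hwB⟩ := hP.exists_walk B
  have hpq : p.tokens = q.tokens :=
    hP.unique hPp hPq (conn_of_reachable (wA.reachable.symm.trans (h.trans wB.reachable)))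
  refine ⟨wA.append (wB.reverse.copy (Subtype.ext hpq.symm) rfl), ?_⟩
  rw [SimpleGraph.Walk.length_append, SimpleGraph.Walk.length_copy,
    SimpleGraph.Walk.length_reverse]
  omega

end Walks

end TokenReconfiguration

theorem mainTheorem6 {V : Type*} [Fintype V] [DecidableEq V] (G : SimpleGraph V)
    (hG : IsCograph G) (k : ℤ) (A B : Finset V) (hAB : TARReachable G k A B) :
    ∃ (p : ℕ) (I : ℕ → Finset V), IsTARSequence G k A B p I ∧
      (p : ℤ) ≤ 4 * (Fintype.card V : ℤ) - (A.card : ℤ) - (B.card : ℤ) := by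
  obtain ⟨T, hT, hverts, rfl⟩ := hG
  obtain ⟨P, hP⟩ := TokenReconfiguration.exists_isSettling_cotree T hT
  obtain ⟨hA, hB, hreachable⟩ := hAB
  rw [hverts] at hP
  obtain ⟨w, hw : w.length + A.card + B.card ≤ 4 * Fintype.card V⟩ :=
    hP.exists_walk_of_reachable hreachable
  exact ⟨_, _, TokenReconfiguration.isTARSequence_getVert w, by omega⟩
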